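/- For $n\in\mathbb N_0$ let $H_n(x)=\frac{(-1)^n}{\sqrt{n!}}\,e^{x^2/2}\,\frac{d^n}{dx^n}e^{-x^2/2}$ be the $n$th probabilists' Hermite polynomial, normalized in $L^2(\mathbb R,\gamma_1)$, where $\gamma_1$ is the standard Gaussian measure on $\mathbb R$. A ReLU network $\Phi:\mathbb R\to\mathbb R$ is a function of the form $\Phi=A_L\circ\sigma\circ A_{L-1}\circ\cdots\circ\sigma\circ A_0$, where $\sigma(x)=\max\{x,0\}$ acts componentwise and $A_j:\mathbb R^{n_j}\to\mathbb R^{n_{j+1}}$, $A_j(x)=W_jx+b_j$, $n_0=n_{L+1}=1$; its depth is $L$, and its size is the total number of nonzero entries of the weight matrices $W_j$ and bias vectors $b_j$ ($0\le j\le L$). For an integer $n\ge 1$ and $\varepsilon\in(0,e^{-1})$ set $$M=M(n,\varepsilon):=\sqrt{24\,\bigl(n\log(2n)-\log\varepsilon\bigr)}.$$ There is a constant $C>0$, independent of $n$ and $\varepsilon$, such that for every integer $n\ge 1$ and every $\varepsilon\in(0,e^{-1})$ there exists a ReLU network $\tilde H_{n,\varepsilon}:\mathbb R\to\mathbb R$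 with 1. $\|H_n-\tilde H_{n,\varepsilon}\|_{L^2(\mathbb R,\gamma_1)}\le 2\varepsilon$; 2. $\tilde H_{n,\varepsilon}(x)=0$ for all $|x|>M$, and $\sup_{x\in\mathbb R}|\tilde H_{n,\varepsilon}(x)|\le 1+(3M)^n$; 3. $\operatorname{size}(\tilde H_{n,\varepsilon})\le C\Bigl(1+n^2\bigl(\log n+\log(-\log\varepsilon)\bigr)+n\log\bigl(\tfrac n\varepsilon\bigr)\Bigr)$ and $\operatorname{depth}(\tilde H_{n,\varepsilon})\le C\bigl(1+n(\log n)^2+n\log n\,\log(-\log\varepsilon)-\log n\,\log\varepsilon\bigr)$. -/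

import Mathlib

noncomputable section

/-- The rectified linear unit, `relu x = max {x, 0}`. -/
def relu (x : ℝ) : ℝ := max x 0

/-- `NeuralNetwork nOut nIn` is the type of (weights and biases of) feedforward neural networks
without skip connections, with input in `ℝ ^ nIn` and output in `ℝ ^ nOut`: finite sequences of
affine maps `A₀, …, A_L`, `A_j x = W_j x + b_j`, with matching dimensions. Either there is only
one affine map `A₀`, or there is a first affine map `A₀ : ℝ ^ nIn → ℝ ^ k` followed by a network
with input in `ℝ ^ k`. -/
inductive NeuralNetwork (nOut : ℕ) : ℕ → Type
  | affine {nIn : ℕ} (W : Matrix (Fin nOut) (Fin nIn) ℝ) (b : Fin nOut → ℝ) :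
      NeuralNetwork nOut nIn
  | layer {nIn k : ℕ} (W : Matrix (Fin k) (Fin nIn) ℝ) (b : Fin k → ℝ)
      (Φ : NeuralNetwork nOut k) : NeuralNetwork nOut nIn

namespace NeuralNetwork

/-- The function `A_L ∘ σ ∘ A_{L-1} ∘ ⋯ ∘ σ ∘ A₀` represented by a network, where the activation
function `σ` acts componentwise. -/
def realize (σ : ℝ → ℝ) {nOut : ℕ} :
    {nIn : ℕ} → NeuralNetwork nOut nIn → (Fin nIn → ℝ) → (Fin nOut → ℝ)
  | _, affine W b, x => W.mulVec x + b
  | _, layer W b Φ, x => Φ.realize σ (fun i => σ ((W.mulVec x + b) i))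

/-- The number `L` of applications of the activation function. -/
def depth {nOut : ℕ} : {nIn : ℕ} → NeuralNetwork nOut nIn → ℕ
  | _, affine _ _ => 0
  | _, layer _ _ Φ => Φ.depth + 1

/-- The number of nonzero entries of a weight matrix and a bias vector. -/
def numNonzero {m n : ℕ} (W : Matrix (Fin m) (Fin n) ℝ) (b : Fin m → ℝ) : ℕ :=
  (Finset.univ.filter fun p : Fin m × Fin n => W p.1 p.2 ≠ 0).card +
    (Finset.univ.filter fun i : Fin m => b i ≠ 0).card

/-- The total number of nonzero weights and biases of a network. -/
def size {nOut : ℕ} : {nIn : ℕ} → NeuralNetwork nOut nIn → ℕ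
  | _, affine W b => numNonzero W b
  | _, layer W b Φ => numNonzero W b + Φ.size

/-- The function `ℝ → ℝ` represented by a ReLU network with scalar input and output. -/
def reluFun (Φ : NeuralNetwork 1 1) (x : ℝ) : ℝ :=
  Φ.realize relu (fun _ => x) 0

end NeuralNetwork

/-- The `n`th probabilists' Hermite polynomial, normalized in `L²(ℝ, γ₁)`:
`H_n(x) = (-1)^n / √(n!) * e^(x²/2) * (d/dx)^n e^(-x²/2)`. -/
def hermiteH (n : ℕ) (x : ℝ) : ℝ :=
  (-1) ^ n / Real.sqrt (n.factorial : ℝ) * Real.exp (x ^ 2 / 2) *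
    iteratedDeriv n (fun y : ℝ => Real.exp (-(y ^ 2 / 2))) x

/-- `hermiteH n` is Mathlib's (monic) Hermite polynomial divided by `√(n!)`. -/
theorem hermiteH_eq_hermite (n : ℕ) (x : ℝ) :
    hermiteH n x = Polynomial.aeval x (Polynomial.hermite n) / Real.sqrt (n.factorial : ℝ) := by
  rw [Polynomial.hermite_eq_deriv_gaussian', hermiteH, iteratedDeriv_eq_iterate]
  ring

/-- The truncation radius `M(n, ε) = √(24 (n log(2n) - log ε))`. -/
def truncRadius (n : ℕ) (ε : ℝ) : ℝ :=
  Real.sqrt (24 * ((n : ℝ) * Real.log (2 * (n : ℝ)) - Real.log ε))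

end

/-! On `[-M, M]` the Hermite polynomial is approximated uniformly; outside it is cut to zero, and
the Gaussian tail pays for the cut.

With `t = (x + M) / (2M)`, the three-term recurrence and `n ≤ M ^ 2` show that `H_n` is a polynomial
in `t` whose coefficients have absolute sum at most `(4M) ^ n` (`isPolyBounded_hermiteH`). The
powers of `t` come from repeated doubling with approximate products. Polarization reduces products
to squares, and `K` iterations of the tent map give squares on the unit interval up to `4 ^ (-K)`
(`sqApprox_bounds`). As all factors lie in `[0, 1]`, errors add: `t ^ k` is off by at most `3 (k -
1) 4 ^ (-K)` (`exists_powers`). Hence `K` of order `n log(4M) - log ε` suffices, with about `log₂ n`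
stages of `K + 5` layers, size `O(nK)` and depth `O(1 + K log n)`.

The approximant `P` is truncated to `[-Bχ, Bχ]`, where `B = 1 + (3M) ^ n` and the cutoff `χ` is `1`
for `|x| ≤ R = 12M/13` and `0` for `|x| ≥ M`. This gives the support and the sup bound. The
truncation is inactive for `|x| ≤ R`; elsewhere the error is at most `max |H_n| ε`, since truncating
moves values towards `0`. There `H_n ^ 2 ≤ 32 ^ n exp(x²/8) ≤ 32 ^ n exp(-R²/4) exp(3x²/8)`. The
last factor has Gaussian mean `2` and `32 ^ n exp(-R²/4) ≤ ε²`, so the squared error is at most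
`3ε²`. -/

/-- The family `g` of functions of a scalar input is computed by the neurons of layer `d` of a ReLU
network whose first `d` layers have total size at most `s`: any network taking the values of `g` as
its inputs can be extended by these layers to a network with scalar input. -/
def LayerComputes (d s : ℕ) {ι : Type} [Fintype ι] (g : ι → ℝ → ℝ) : Prop :=
  ∃ (k : ℕ) (e : ι ≃ Fin k), ∀ Φ : NeuralNetwork 1 k, ∃ Ψ : NeuralNetwork 1 1,
    Ψ.depth = Φ.depth + d ∧ Ψ.size ≤ Φ.size + s ∧
    ∀ x, Ψ.realize relu (fun _ => x) = Φ.realize relu (fun i => g (e.symm i) x)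

/-! ### Assembling networks layer by layer -/

theorem relu_of_nonneg {x : ℝ} (h : 0 ≤ x) : relu x = x := max_eq_left h

theorem relu_of_nonpos {x : ℝ} (h : x ≤ 0) : relu x = 0 := max_eq_right h

namespace LayerComputes

theorem id : LayerComputes 0 0 (fun (_ : Unit) (x : ℝ) => x) :=
  ⟨1, Equiv.ofUnique _ _, fun Φ => ⟨Φ, rfl, le_rfl, fun _ => rfl⟩⟩

theorem mono {d s s' : ℕ} {ι : Type} [Fintype ι] {g : ι → ℝ → ℝ} (h : LayerComputes d s g)
    (hs : s ≤ s') : LayerComputes d s' g := by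
  obtain ⟨k, e, h⟩ := h
  refine ⟨k, e, fun Φ => ?_⟩
  obtain ⟨Ψ, h1, h2, h3⟩ := h Φ
  exact ⟨Ψ, h1, h2.trans (by omega), h3⟩

theorem weaken {d d' s s' : ℕ} {ι : Type} [Fintype ι] {g : ι → ℝ → ℝ} (h : LayerComputes d s g)
    (hd : d = d') (hs : s ≤ s') : LayerComputes d' s' g :=
  hd ▸ h.mono hs

open Classical in
/-- The weight of index `i` in a sparse row, given as a list of indices and coefficients. -/
noncomputable def rowWeight {ι : Type} (l : List (ι × ℝ)) (i : ι) : ℝ :=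
  (l.map fun p => if p.1 = i then p.2 else 0).sum

theorem sum_rowWeight_mul {ι : Type} [Fintype ι] (l : List (ι × ℝ)) (y : ι → ℝ) :
    ∑ i, rowWeight l i * y i = (l.map fun p => p.2 * y p.1).sum := by
  induction l with
  | nil => simp [rowWeight]
  | cons p l ih =>
    simp only [rowWeight, List.map_cons, List.sum_cons, add_mul, Finset.sum_add_distrib] at ih ⊢
    rw [ih, Finset.sum_eq_single p.1 (fun i _ hi => by simp [hi.symm]) (by simp), if_pos rfl]

theorem card_rowWeight_ne_zero_le {ι : Type} [Fintype ι] (l : List (ι × ℝ)) :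
    (Finset.univ.filter fun i => rowWeight l i ≠ 0).card ≤ l.length := by
  classical
  calc _ ≤ (l.map Prod.fst).toFinset.card := by
        refine Finset.card_le_card fun i hi => ?_
        simp only [Finset.mem_filter, Finset.mem_univ, true_and] at hi
        by_contra hmem
        refine hi (List.sum_eq_zero fun a ha => ?_)
        obtain ⟨p, hp, rfl⟩ := List.mem_map.1 ha
        rw [if_neg]
        rintro rfl
        exact hmem (List.mem_toFinset.2 (List.mem_map.2 ⟨p, hp, rfl⟩))
    _ ≤ _ := (List.toFinset_card_le _).trans (by simp)

theorem numNonzero_rowWeight_le {k m N : ℕ} (row : Fin m → List (Fin k × ℝ)) (b : Fin m → ℝ)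
    (hN : ∀ j, (row j).length ≤ N) :
    NeuralNetwork.numNonzero (fun j i => rowWeight (row j) i : Matrix (Fin m) (Fin k) ℝ) b
      ≤ m * (N + 1) := by
  have h1 : (Finset.univ.filter fun p : Fin m × Fin k => rowWeight (row p.1) p.2 ≠ 0).card
      ≤ m * N := by
    rw [← Finset.univ_product_univ, Finset.card_filter, Finset.sum_product]
    simp only [← Finset.card_filter]
    refine (Finset.sum_le_card_nsmul _ _ N
      fun j _ => (card_rowWeight_ne_zero_le _).trans (hN j)).trans (by simp)
  have h2 : (Finset.univ.filter fun i : Fin m => b i ≠ 0).card ≤ m :=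
    (Finset.card_filter_le _ _).trans (by simp)
  rw [mul_add, mul_one]
  exact add_le_add h1 h2

/-- Appending one layer whose weight matrix has at most `N` nonzero entries in each row. -/
theorem step {d s N : ℕ} {ι κ : Type} [Fintype ι] [Fintype κ] {g : ι → ℝ → ℝ}
    (hg : LayerComputes d s g) (h : κ → ℝ → ℝ) (row : κ → List (ι × ℝ)) (b : κ → ℝ)
    (hN : ∀ j, (row j).length ≤ N)
    (hh : ∀ j x, h j x = relu (((row j).map fun p => p.2 * g p.1 x).sum + b j)) :
    LayerComputes (d + 1) (s + Fintype.card κ * (N + 1)) h := by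
  obtain ⟨k, e, hg⟩ := hg
  let f := Fintype.equivFin κ
  refine ⟨_, f, fun Φ => ?_⟩
  let row' : Fin (Fintype.card κ) → List (Fin k × ℝ) :=
    fun j => (row (f.symm j)).map fun p => (e p.1, p.2)
  obtain ⟨Ψ, h1, h2, h3⟩ := hg (.layer (fun j i => rowWeight (row' j) i) (fun j => b (f.symm j)) Φ)
  have hsize := numNonzero_rowWeight_le (N := N) row' (fun j => b (f.symm j))
    (fun j => by simpa [row'] using hN _)
  refine ⟨Ψ, ?_, ?_, fun x => ?_⟩
  · simp only [h1, NeuralNetwork.depth]; omega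
  · simp only [NeuralNetwork.size] at h2; omega
  · simp only [h3, NeuralNetwork.realize]
    congr 1
    funext j
    rw [hh, Pi.add_apply]
    simp only [Matrix.mulVec, dotProduct]
    rw [sum_rowWeight_mul]
    simp [row', List.map_map, Function.comp_def]

/-- Reading off an affine combination of the neurons of the last layer. -/
theorem exists_network {d s : ℕ} {ι : Type} [Fintype ι] {g : ι → ℝ → ℝ}
    (hg : LayerComputes d s g) (l : List (ι × ℝ)) (b : ℝ) :
    ∃ Φ : NeuralNetwork 1 1, Φ.depth = d ∧ Φ.size ≤ s + (l.length + 1) ∧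
      ∀ x, Φ.reluFun x = (l.map fun p => p.2 * g p.1 x).sum + b := by
  obtain ⟨k, e, hg⟩ := hg
  let row' : Fin 1 → List (Fin k × ℝ) := fun _ => l.map fun p => (e p.1, p.2)
  obtain ⟨Ψ, h1, h2, h3⟩ := hg (.affine (fun j i => rowWeight (row' j) i) (fun _ => b))
  have hsize := numNonzero_rowWeight_le (N := l.length) row' (fun _ => b) (fun j => by simp [row'])
  refine ⟨Ψ, ?_, ?_, fun x => ?_⟩
  · simp only [h1, NeuralNetwork.depth]; omega
  · simp only [NeuralNetwork.size] at h2; omega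
  · simp only [NeuralNetwork.reluFun, h3, NeuralNetwork.realize, Pi.add_apply]
    simp only [Matrix.mulVec, dotProduct]
    rw [sum_rowWeight_mul]
    simp [row', List.map_map, Function.comp_def]

end LayerComputes

/-! ### Approximate squares and products on the unit interval -/

/-- The tent map of the unit interval. -/
noncomputable def tent (u : ℝ) : ℝ := 2 * relu u - 4 * relu (u - 1 / 2)

theorem tent_of_le {u : ℝ} (h0 : 0 ≤ u) (h : u ≤ 1 / 2) : tent u = 2 * u := by
  rw [tent, relu_of_nonneg h0, relu_of_nonpos (by linarith)]; ring

theorem tent_of_ge {u : ℝ} (h : 1 / 2 ≤ u) : tent u = 2 - 2 * u := by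
  rw [tent, relu_of_nonneg (by linarith), relu_of_nonneg (by linarith)]; ring

theorem tent_mem {u : ℝ} (hu : u ∈ Set.Icc (0 : ℝ) 1) : tent u ∈ Set.Icc (0 : ℝ) 1 := by
  obtain ⟨h0, h1⟩ := hu
  rcases le_total u (1 / 2) with h | h
  · rw [tent_of_le h0 h]; constructor <;> linarith
  · rw [tent_of_ge h]; constructor <;> linarith

theorem iterate_tent_mem {u : ℝ} (hu : u ∈ Set.Icc (0 : ℝ) 1) (K : ℕ) :
    tent^[K] u ∈ Set.Icc (0 : ℝ) 1 := by
  induction K with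
  | zero => exact hu
  | succ K ih => rw [Function.iterate_succ_apply']; exact tent_mem ih

/-- Iterating this self-similarity `K` times leaves a remainder divided by `4 ^ K`, which is exactly
the error of `sqApprox K`. -/
theorem sub_sq_eq_tent {u : ℝ} (hu : u ∈ Set.Icc (0 : ℝ) 1) :
    u - u ^ 2 = tent u / 4 + (tent u - tent u ^ 2) / 4 := by
  rcases le_total u (1 / 2) with h | h
  · rw [tent_of_le hu.1 h]; ring
  · rw [tent_of_ge h]; ring

/-- The piecewise linear interpolation of `u ^ 2` on the dyadic grid of mesh `2 ^ (-K)`. -/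
noncomputable def sqApprox (K : ℕ) (u : ℝ) : ℝ :=
  u - ∑ l ∈ Finset.range K, tent^[l + 1] u / 4 ^ (l + 1)

theorem sqApprox_zero (u : ℝ) : sqApprox 0 u = u := by simp [sqApprox]

theorem sqApprox_succ (K : ℕ) (u : ℝ) :
    sqApprox (K + 1) u = sqApprox K u - tent (tent^[K] u) / 4 ^ (K + 1) := by
  rw [sqApprox, sqApprox, Finset.sum_range_succ, Function.iterate_succ_apply']; ring

theorem sqApprox_sub_sq {u : ℝ} (hu : u ∈ Set.Icc (0 : ℝ) 1) (K : ℕ) :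
    sqApprox K u - u ^ 2 = (tent^[K] u - (tent^[K] u) ^ 2) / 4 ^ K := by
  induction K with
  | zero => simp [sqApprox]
  | succ K ih =>
    have h := sub_sq_eq_tent (iterate_tent_mem hu K)
    rw [h] at ih
    rw [sqApprox_succ, Function.iterate_succ_apply', sub_right_comm, ih, pow_succ]
    field_simp
    ring

theorem sqApprox_bounds {u : ℝ} (hu : u ∈ Set.Icc (0 : ℝ) 1) (K : ℕ) :
    u ^ 2 ≤ sqApprox K u ∧ sqApprox K u ≤ u ^ 2 + 1 / 4 ^ K := by
  have h := sqApprox_sub_sq hu K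
  obtain ⟨h0, h1⟩ := iterate_tent_mem hu K
  have h2 : 0 ≤ tent^[K] u - (tent^[K] u) ^ 2 := by nlinarith
  have h3 : tent^[K] u - (tent^[K] u) ^ 2 ≤ 1 := by nlinarith
  have h4 : (0 : ℝ) < 4 ^ K := by positivity
  have h5 := div_nonneg h2 h4.le
  have h6 := div_le_div_of_nonneg_right h3 h4.le
  constructor <;> linarith

/-- The projection of the real line onto the unit interval. -/
noncomputable def clip (z : ℝ) : ℝ := relu (1 - relu (1 - z))

theorem clip_eq (z : ℝ) : clip z = max 0 (min 1 z) := by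
  rcases le_total 1 z with h | h
  · rw [clip, relu_of_nonpos (x := 1 - z) (by linarith), min_eq_left h, relu]; norm_num
  · rw [clip, relu_of_nonneg (x := 1 - z) (by linarith), min_eq_right h, sub_sub_cancel, relu,
      max_comm]

theorem clip_mem (z : ℝ) : clip z ∈ Set.Icc (0 : ℝ) 1 := by
  rw [clip_eq]
  exact ⟨le_max_left _ _, max_le zero_le_one (min_le_left _ _)⟩

theorem clip_of_mem {z : ℝ} (h : z ∈ Set.Icc (0 : ℝ) 1) : clip z = z := by
  rw [clip_eq, min_eq_right h.2, max_eq_right h.1]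

theorem clip_of_nonpos {z : ℝ} (h : z ≤ 0) : clip z = 0 := by
  rw [clip_eq, min_eq_right (h.trans zero_le_one), max_eq_left h]

theorem clip_of_one_le {z : ℝ} (h : 1 ≤ z) : clip z = 1 := by
  rw [clip_eq, min_eq_left h, max_eq_right zero_le_one]

theorem abs_clip_sub_le {y : ℝ} (hy : y ∈ Set.Icc (0 : ℝ) 1) (z : ℝ) :
    |clip z - y| ≤ |z - y| := by
  obtain ⟨h0, h1⟩ := hy
  rcases le_total z 0 with h | h
  · rw [clip_of_nonpos h, abs_le]
    constructor <;> cases abs_cases (z - y) <;> linarith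
  rcases le_total z 1 with h' | h'
  · rw [clip_of_mem ⟨h, h'⟩]
  · rw [clip_of_one_le h', abs_le]
    constructor <;> cases abs_cases (z - y) <;> linarith

/-- The product of two numbers of the unit interval, computed through approximate squares. -/
noncomputable def mulApprox (K : ℕ) (a b : ℝ) : ℝ :=
  clip (2 * sqApprox K ((a + b) / 2) - 1 / 2 * sqApprox K a - 1 / 2 * sqApprox K b)

theorem abs_mulApprox_sub_mul_le {a b : ℝ} (ha : a ∈ Set.Icc (0 : ℝ) 1)
    (hb : b ∈ Set.Icc (0 : ℝ) 1) (K : ℕ) : |mulApprox K a b - a * b| ≤ 3 * (1 / 4 ^ K) := by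
  have hm : (a + b) / 2 ∈ Set.Icc (0 : ℝ) 1 := by
    constructor <;> linarith [ha.1, ha.2, hb.1, hb.2]
  have hab : a * b ∈ Set.Icc (0 : ℝ) 1 := unitInterval.mul_mem ha hb
  refine (abs_clip_sub_le hab _).trans ?_
  have h1 := sqApprox_bounds ha K
  have h2 := sqApprox_bounds hb K
  have h3 := sqApprox_bounds hm K
  have h4 : (0 : ℝ) ≤ 1 / 4 ^ K := by positivity
  rw [abs_le]
  constructor <;> nlinarith

/-- Factors in `[0, 1]` do not amplify errors, so the errors of the two factors simply add; this
keeps the error of `t ^ k` linear in `k`. -/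
theorem abs_mulApprox_sub_mul_le_add {a b y z : ℝ} (ha : a ∈ Set.Icc (0 : ℝ) 1)
    (hb : b ∈ Set.Icc (0 : ℝ) 1) (hy : y ∈ Set.Icc (0 : ℝ) 1) (K : ℕ) :
    |mulApprox K a b - y * z| ≤ 3 * (1 / 4 ^ K) + |a - y| + |b - z| := by
  have h1 := abs_mulApprox_sub_mul_le ha hb K
  have h2 : |a * b - y * z| ≤ |a - y| + |b - z| := by
    rw [show a * b - y * z = (a - y) * b + y * (b - z) by ring]
    refine (abs_add_le _ _).trans (add_le_add ?_ ?_)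
    · rw [abs_mul, abs_of_nonneg hb.1]
      exact mul_le_of_le_one_right (abs_nonneg _) hb.2
    · rw [abs_mul, abs_of_nonneg hy.1]
      exact mul_le_of_le_one_left (abs_nonneg _) hy.2
  have h3 := abs_add_le (mulApprox K a b - a * b) (a * b - y * z)
  rw [sub_add_sub_cancel] at h3
  linarith

/-! ### Squares, products and powers as layers -/

namespace LayerComputes

variable {d s : ℕ} {ι : Type} [Fintype ι] {g : ι → ℝ → ℝ}

/-- The state after `K` refinements of the approximate squares of all `g i` with `keep i = false`;
the other functions are passed on unchanged. -/
theorem squares_aux (hg : LayerComputes d s g) (hg01 : ∀ i x, g i x ∈ Set.Icc (0 : ℝ) 1)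
    (keep : ι → Bool) (K : ℕ) :
    LayerComputes (d + (K + 1)) (s + 12 * Fintype.card ι * (K + 1))
      (fun (p : ι × Fin 3) x => (![tent^[K] (g p.1 x), relu (tent^[K] (g p.1 x) - 1 / 2),
        if keep p.1 then g p.1 x else sqApprox K (g p.1 x)] : Fin 3 → ℝ) p.2) := by
  induction K with
  | zero =>
    refine (hg.step (N := 1) _ (fun p => [(p.1, 1)]) (fun p => ![0, -1 / 2, 0] p.2) (by simp)
      ?_).mono (by simp; omega)
    rintro ⟨i, j⟩ x
    have h := relu_of_nonneg (hg01 i x).1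
    fin_cases j
    · simp [h]
    · simp; ring_nf
    · simp [h, sqApprox_zero]
  | succ K ih =>
    -- With `s` the current tent iterate, `tent s = 2 s - 4 relu (s - 1/2)` is linear in the first
    -- two neurons. The third row subtracts `tent s / 4 ^ (K + 1)`, or nothing if the value is kept.
    -- All values passed on are nonnegative, so `relu` leaves them unchanged.
    refine (ih.step (N := 3) _ (fun p => ![[((p.1, 0), 2), ((p.1, 1), -4)],
        [((p.1, 0), 2), ((p.1, 1), -4)],
        [((p.1, 2), 1), ((p.1, 0), if keep p.1 then 0 else -2 / 4 ^ (K + 1)),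
          ((p.1, 1), if keep p.1 then 0 else 4 / 4 ^ (K + 1))]] p.2)
      (fun p => ![0, -1 / 2, 0] p.2) ?_ ?_).mono ?_
    · rintro ⟨i, j⟩
      fin_cases j <;> simp
    · rintro ⟨i, j⟩ x
      have hmem := iterate_tent_mem (hg01 i x) K
      have ht : 2 * tent^[K] (g i x) + -(4 * relu (tent^[K] (g i x) - 1 / 2))
          = tent (tent^[K] (g i x)) := by
        rw [tent, relu_of_nonneg hmem.1]; ring
      fin_cases j
      · simp only [Function.iterate_succ_apply']
        simp
        simp at ht
        rw [ht, relu_of_nonneg (tent_mem hmem).1]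
      · simp only [Function.iterate_succ_apply']
        simp
        simp at ht
        rw [ht]; ring_nf
      · have hs := sqApprox_succ K (g i x)
        have hs0 := (sq_nonneg _).trans (sqApprox_bounds (hg01 i x) (K + 1)).1
        cases hk : keep i
        · rw [← ht] at hs
          simp [hk]
          rw [← relu_of_nonneg hs0]
          congr 1
          rw [hs]
          simp
          ring
        · simp [hk, relu_of_nonneg (hg01 i x).1]
    · simp only [Fintype.card_prod, Fintype.card_fin]
      nlinarith

theorem squares (hg : LayerComputes d s g) (hg01 : ∀ i x, g i x ∈ Set.Icc (0 : ℝ) 1)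
    (keep : ι → Bool) (K : ℕ) :
    LayerComputes (d + (K + 2)) (s + 12 * Fintype.card ι * (K + 2))
      (fun i x => if keep i then g i x else sqApprox K (g i x)) := by
  refine ((squares_aux hg hg01 keep K).step (N := 1) _ (fun i => [((i, 2), 1)]) 0 (by simp)
    ?_).mono (by nlinarith)
  intro i x
  have hs0 := (sq_nonneg _).trans (sqApprox_bounds (hg01 i x) K).1
  cases hk : keep i
  · simp [hk, relu_of_nonneg hs0]
  · simp [hk, relu_of_nonneg (hg01 i x).1]

/-- Multiplying each function of a family by a fixed member of the family. -/
theorem mul_member (hg : LayerComputes d s g) (hg01 : ∀ i x, g i x ∈ Set.Icc (0 : ℝ) 1)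
    (m : ι) (K : ℕ) :
    LayerComputes (d + (K + 5)) (s + 36 * Fintype.card ι * (K + 5))
      (Sum.elim g fun i x => mulApprox K (g m x) (g i x)) := by
  have hrelu := fun i x => relu_of_nonneg (hg01 i x).1
  -- Layer count: one layer forms the averages for polarization, `K + 2` the squares, and two
  -- realize `clip`.
  have h1 : LayerComputes (d + 1) (s + 9 * Fintype.card ι)
      (Sum.elim g (Sum.elim g fun i x => (g m x + g i x) / 2)) := by
    refine (hg.step (N := 2) _ (Sum.elim (fun i => [(i, 1)]) (Sum.elim (fun i => [(i, 1)])
      fun i => [(m, 1 / 2), (i, 1 / 2)])) 0 (by simp) ?_).mono (by simp; omega)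
    rintro (i | i | i) x
    · simp [hrelu]
    · simp [hrelu]
    · have h : 0 ≤ (g m x + g i x) / 2 := by linarith [(hg01 i x).1, (hg01 m x).1]
      simp only [Sum.elim_inr]
      nth_rewrite 1 [← relu_of_nonneg h]
      congr 1
      simp
      ring
  have h2 := h1.squares (by
    rintro (i | i | i) x
    · exact hg01 i x
    · exact hg01 i x
    · simp only [Sum.elim_inr]
      constructor <;> linarith [(hg01 i x).1, (hg01 m x).1, (hg01 i x).2, (hg01 m x).2])
    (Sum.elim (fun _ => true) fun _ => false) K
  have h3 := h2.step (N := 3) (Sum.elim g fun i x => relu (1 - (2 * sqApprox K ((g m x + g i x) / 2)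
      - 1 / 2 * sqApprox K (g m x) - 1 / 2 * sqApprox K (g i x))))
    (Sum.elim (fun i => [(.inl i, 1)]) fun i => [(.inr (.inr i), -2), (.inr (.inl m), 1 / 2),
      (.inr (.inl i), 1 / 2)]) (Sum.elim 0 1) (by simp) (by
    rintro (i | i) x
    · simp [hrelu]
    · simp only [Sum.elim_inr]
      congr 1
      simp
      ring)
  refine (h3.step (N := 1) _ (Sum.elim (fun i => [(.inl i, 1)]) fun i => [(.inr i, -1)])
    (Sum.elim 0 1) (by simp) ?_).weaken (by ring) ?_
  · rintro (i | i) x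
    · simp [hrelu]
    · simp only [Sum.elim_inr, mulApprox, clip]
      congr 1
      simp
      ring
  · simp only [Fintype.card_sum]
    nlinarith

/-- Each stage multiplies the whole family by the approximation of `g i₀ ^ 2 ^ J`, doubling both the
family and the range of available exponents. The errors satisfy `3 + 3 (a - 1) + 3 (b - 1) = 3 (a +
b - 1)`. The member `g i₁` is carried along exactly; it will be the cutoff. -/
theorem exists_powers (hg : LayerComputes d s g) (hg01 : ∀ i x, g i x ∈ Set.Icc (0 : ℝ) 1)
    {i₀ i₁ : ι} (K J : ℕ) :
    ∃ (κ : Type) (_ : Fintype κ) (h : κ → ℝ → ℝ),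
      LayerComputes (d + J * (K + 5)) (s + 36 * Fintype.card ι * 2 ^ J * (K + 5)) h ∧
      Fintype.card κ = Fintype.card ι * 2 ^ J ∧ (∀ i x, h i x ∈ Set.Icc (0 : ℝ) 1) ∧
      (∃ j, h j = g i₁) ∧
      ∀ k : ℕ, 1 ≤ k → k ≤ 2 ^ J →
        ∃ j, ∀ x, |h j x - g i₀ x ^ k| ≤ 3 * ((k : ℝ) - 1) * (1 / 4 ^ K) := by
  induction J with
  | zero =>
    refine ⟨ι, _, g, hg.weaken (by simp) (by omega), by simp, hg01, ⟨i₁, rfl⟩, fun k h1 h2 => ⟨i₀, fun x => ?_⟩⟩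
    obtain rfl : k = 1 := by rw [pow_zero] at h2; omega
    simp
  | succ J ih =>
    obtain ⟨κ, _, h, hh, hc, h01, ⟨j₁, hj₁⟩, hpow⟩ := ih
    obtain ⟨m, hm⟩ := hpow (2 ^ J) Nat.one_le_two_pow le_rfl
    refine ⟨κ ⊕ κ, _, Sum.elim h fun i x => mulApprox K (h m x) (h i x),
      (hh.mul_member h01 m K).weaken (by ring) ?_, ?_, ?_, ⟨.inl j₁, hj₁⟩, ?_⟩
    · rw [hc, pow_succ]
      apply le_of_eq
      ring
    · rw [Fintype.card_sum, hc, pow_succ]; ring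
    · rintro (i | i) x
      · exact h01 i x
      · exact clip_mem _
    · intro k h1 h2
      rcases le_or_gt k (2 ^ J) with hk | hk
      · obtain ⟨j, hj⟩ := hpow k h1 hk
        exact ⟨.inl j, hj⟩
      · obtain ⟨l, rfl⟩ := Nat.exists_eq_add_of_lt hk
        obtain ⟨j, hj⟩ := hpow (l + 1) (by omega) (by rw [pow_succ] at h2; omega)
        refine ⟨.inr j, fun x => ?_⟩
        have hy : g i₀ x ^ 2 ^ J ∈ Set.Icc (0 : ℝ) 1 :=
          ⟨pow_nonneg (hg01 _ _).1 _, pow_le_one₀ (hg01 _ _).1 (hg01 _ _).2⟩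
        have := abs_mulApprox_sub_mul_le_add (z := g i₀ x ^ (l + 1)) (h01 m x) (h01 j x) hy K
        rw [← pow_add] at this
        refine this.trans ?_
        have e1 := hm x
        have e2 := hj x
        push_cast at e1 e2 ⊢
        linarith

end LayerComputes

/-! ### Truncation to a symmetric interval -/

theorem relu_add_sub_relu_sub_of_abs_le {p v : ℝ} (h : |p| ≤ v) :
    relu (p + v) - relu (p - v) - v = p := by
  obtain ⟨h1, h2⟩ := abs_le.1 h
  rw [relu_of_nonneg (by linarith), relu_of_nonpos (by linarith)]
  ring

theorem relu_add_sub_relu_sub_eq {p v : ℝ} (hv : 0 ≤ v) :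
    relu (p + v) - relu (p - v) - v = max (-v) (min v p) := by
  rcases le_total p (-v) with h | h
  · rw [relu_of_nonpos (by linarith), relu_of_nonpos (by linarith), min_eq_right (by linarith),
      max_eq_left h]
    ring
  rcases le_total p v with h' | h'
  · rw [relu_add_sub_relu_sub_of_abs_le (abs_le.2 ⟨h, h'⟩), min_eq_right h', max_eq_right h]
  · rw [relu_of_nonneg (by linarith), relu_of_nonneg (by linarith), min_eq_left h',
      max_eq_right (by linarith)]
    ring

theorem abs_max_neg_min_le {p v : ℝ} (hv : 0 ≤ v) : |max (-v) (min v p)| ≤ v :=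
  abs_le.2 ⟨le_max_left _ _, max_le (by linarith) (min_le_left _ _)⟩

/-- The truncated value lies between `0` and `p`, and the distance to `y` is convex. -/
theorem abs_max_neg_min_sub_le {p v : ℝ} (hv : 0 ≤ v) (y : ℝ) :
    |max (-v) (min v p) - y| ≤ max |y| |p - y| := by
  rcases le_total p (-v) with h | h
  · rw [min_eq_right (by linarith), max_eq_left h, le_max_iff, or_iff_not_imp_left]
    intro hy
    rcases abs_cases y with ⟨h1, h2⟩ | ⟨h1, h2⟩ <;>
      rcases abs_cases (-v - y) with ⟨h3, h4⟩ | ⟨h3, h4⟩ <;>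
      rcases abs_cases (p - y) with ⟨h5, h6⟩ | ⟨h5, h6⟩ <;> linarith
  rcases le_total p v with h' | h'
  · rw [min_eq_right h', max_eq_right h]
    exact le_max_right _ _
  · rw [min_eq_left h', max_eq_right (by linarith), le_max_iff, or_iff_not_imp_left]
    intro hy
    rcases abs_cases y with ⟨h1, h2⟩ | ⟨h1, h2⟩ <;>
      rcases abs_cases (v - y) with ⟨h3, h4⟩ | ⟨h3, h4⟩ <;>
      rcases abs_cases (p - y) with ⟨h5, h6⟩ | ⟨h5, h6⟩ <;> linarith

/-! ### Networks for truncated polynomials -/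

namespace LayerComputes

/-- The two functions of the input on which the approximation of polynomials is based: the affine
coordinate on `[-M, M]` and a cutoff function. -/
theorem coordinate_cutoff (R M : ℝ) :
    LayerComputes 3 16 (fun (i : Bool) x =>
      if i then clip ((x + M) / (2 * M)) else clip ((M - |x|) / (M - R))) := by
  have h1 := id.step (N := 1) (fun (i : Fin 3) x =>
      (![relu (1 - (x + M) / (2 * M)), relu x, relu (-x)] : Fin 3 → ℝ) i)
    -- The bias is not simplified to `1/2`, because `M = 0` is not excluded here.
    (fun i => [((), ![-1 / (2 * M), 1, -1] i)]) ![1 - M / (2 * M), 0, 0] (by simp) (by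
    intro i x
    fin_cases i
    · simp only [Fin.zero_eta, Matrix.cons_val_zero, List.map_cons, List.map_nil, List.sum_cons,
        List.sum_nil]
      congr 1
      ring
    · simp
    · simp)
  have h2 := h1.step (N := 2) (fun (i : Bool) x =>
      if i then clip ((x + M) / (2 * M)) else relu (1 - (M - |x|) / (M - R)))
    (fun i => if i then [(0, -1)] else [(1, 1 / (M - R)), (2, 1 / (M - R))])
    (fun i => if i then 1 else 1 - M / (M - R)) (by simp) (by
    rintro (_ | _) x
    · have h : |x| = relu x + relu (-x) := by
        rcases le_total 0 x with h | h
        · rw [abs_of_nonneg h, relu_of_nonneg h, relu_of_nonpos (by linarith), add_zero]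
        · rw [abs_of_nonpos h, relu_of_nonpos h, relu_of_nonneg (by linarith), zero_add]
      rw [h]
      simp only [Bool.false_eq_true, if_false]
      congr 1
      simp
      ring
    · simp only [if_true, clip]
      congr 1
      simp
      ring)
  refine (h2.step (N := 1) _ (fun i => if i then [(true, 1)] else [(false, -1)])
    (fun i => if i then 0 else 1) (by simp) ?_).weaken (by simp) (by simp)
  rintro (_ | _) x
  · simp only [Bool.false_eq_true, if_false]
    rw [clip]
    congr 1
    simp
    ring
  · simp [relu_of_nonneg (clip_mem _).1]

end LayerComputes

/-- Approximation of a polynomial in the affine coordinate of `[-M, M]` by a ReLU network, truncated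
to a multiple of a cutoff function. -/
theorem exists_network_truncated_polynomial (n K : ℕ) (R M B : ℝ) (c : ℕ → ℝ) :
    ∃ (Φ : NeuralNetwork 1 1) (P : ℝ → ℝ),
      Φ.depth = 4 + Nat.clog 2 n * (K + 5) ∧
      Φ.size ≤ 26 + 72 * 2 ^ Nat.clog 2 n * (K + 5) + 3 * n ∧
      (∀ x, |P x - ∑ k ∈ Finset.range (n + 1), c k * clip ((x + M) / (2 * M)) ^ k|
        ≤ (∑ k ∈ Finset.range (n + 1), |c k|) * (3 * n * (1 / 4 ^ K))) ∧
      ∀ x, Φ.reluFun x = relu (P x + B * clip ((M - |x|) / (M - R)))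
        - relu (P x - B * clip ((M - |x|) / (M - R))) - B * clip ((M - |x|) / (M - R)) := by
  obtain ⟨κ, _, h, hh, -, h01, ⟨j₁, hj₁⟩, hpow⟩ := (LayerComputes.coordinate_cutoff R M).exists_powers
    (by rintro (_ | _) x <;> exact clip_mem _) (i₀ := true) (i₁ := false) K (Nat.clog 2 n)
  -- The neuron for the power `k + 1`. The guard `k < n` inside the existential makes the choice
  -- total; for `k ≥ n` the default `j₁` is never used.
  have hex : ∀ k : ℕ, ∃ j, k < n → ∀ x, |h j x - clip ((x + M) / (2 * M)) ^ (k + 1)|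
      ≤ 3 * n * (1 / 4 ^ K) := by
    intro k
    rcases lt_or_ge k n with hk | hk
    · obtain ⟨j, hj⟩ := hpow (k + 1) (by omega)
        ((Nat.succ_le_of_lt hk).trans (Nat.le_pow_clog one_lt_two n))
      refine ⟨j, fun _ x => (hj x).trans ?_⟩
      have : (k : ℝ) ≤ n := by exact_mod_cast hk.le
      gcongr
      push_cast
      linarith
    · exact ⟨j₁, fun h => absurd h (by omega)⟩
  choose j hj using hex
  let P : ℝ → ℝ := fun x => ∑ k ∈ Finset.range n, c (k + 1) * h (j k) x + c 0
  have hlist : ∀ x, (((List.range n).map fun k => (j k, c (k + 1))).map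
      fun p => p.2 * h p.1 x).sum = ∑ k ∈ Finset.range n, c (k + 1) * h (j k) x := by
    intro x
    rw [List.map_map]
    rfl
  have h3 := hh.step (N := n + 1) (fun (i : Fin 3) x => (![relu (P x + B * h j₁ x),
      relu (P x - B * h j₁ x), relu (h j₁ x)] : Fin 3 → ℝ) i)
    ![(j₁, B) :: (List.range n).map fun k => (j k, c (k + 1)),
      (j₁, -B) :: (List.range n).map fun k => (j k, c (k + 1)), [(j₁, 1)]] ![c 0, c 0, 0]
    (by intro i; fin_cases i <;> simp) (by
    intro i x
    have hl := hlist x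
    fin_cases i
    · simp only [Fin.zero_eta, Matrix.cons_val_zero, List.map_cons, List.sum_cons, hlist, P]
      congr 1
      ring
    · simp only [Fin.mk_one, Matrix.cons_val_one, Matrix.cons_val_zero, List.map_cons,
        List.sum_cons, hlist, P]
      congr 1
      ring
    · simp)
  obtain ⟨Φ, hd, hs, hΦ⟩ := h3.exists_network [(0, 1), (1, -1), (2, -B)] 0
  -- The constant `26` is `16` for the coordinate and cutoff, `6` from `3 (n + 2)` for the
  -- truncation layer, and `4` for the output.
  refine ⟨Φ, P, by rw [hd]; ring, hs.trans ?_, fun x => ?_, fun x => ?_⟩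
  · simp
    ring_nf
    omega
  · have e : P x - ∑ k ∈ Finset.range (n + 1), c k * clip ((x + M) / (2 * M)) ^ k
        = ∑ k ∈ Finset.range n, c (k + 1) * (h (j k) x - clip ((x + M) / (2 * M)) ^ (k + 1)) := by
      rw [Finset.sum_range_succ', pow_zero, mul_one]
      simp only [mul_sub, Finset.sum_sub_distrib, P]
      ring
    rw [e, Finset.sum_range_succ', add_mul, Finset.sum_mul]
    refine (Finset.abs_sum_le_sum_abs _ _).trans
      ((Finset.sum_le_sum fun k hk => ?_).trans (le_add_of_nonneg_right (by positivity)))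
    rw [abs_mul]
    exact mul_le_mul_of_nonneg_left (hj k (Finset.mem_range.1 hk) x) (abs_nonneg _)
  · rw [hΦ]
    have h1 : h j₁ x = clip ((M - |x|) / (M - R)) := by simp [hj₁]
    simp [h1, relu_of_nonneg (clip_mem _).1]
    ring

/-! ### Values and coefficients of Hermite polynomials -/

-- The Appell property turns `hermite_succ`, which involves a derivative, into the three-term
-- recurrence.
open Polynomial in
theorem derivative_hermite_succ (n : ℕ) :
    derivative (hermite (n + 1)) = (n + 1 : ℤ[X]) * hermite n := by
  induction n with
  | zero => simp
  | succ n ih =>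
    rw [hermite_succ (n + 1), derivative_sub, derivative_mul, derivative_X, ih]
    have h2 : derivative ((n + 1 : ℤ[X]) * hermite n) = (n + 1 : ℤ[X]) * derivative (hermite n) := by
      rw [derivative_mul]; simp
    rw [h2, hermite_succ n]
    push_cast
    ring

open Polynomial in
theorem hermite_succ_succ (n : ℕ) :
    hermite (n + 2) = X * hermite (n + 1) - (n + 1 : ℤ[X]) * hermite n := by
  rw [hermite_succ (n + 1), derivative_hermite_succ]

open Polynomial in
theorem aeval_hermite_succ_succ (n : ℕ) (x : ℝ) :
    aeval x (hermite (n + 2)) = x * aeval x (hermite (n + 1)) - (n + 1) * aeval x (hermite n) := by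
  rw [hermite_succ_succ]; simp

/-- The recurrence closes since `2 r² + r² ≤ (2r)²`. The cap `N` is separate from `n`, so that the
hypothesis on `r` is fixed during the induction. -/
theorem abs_aeval_hermite_le {N : ℕ} {x r : ℝ} (hr : 0 < r) (hN : N ≤ r ^ 2) (hx : |x| ≤ r)
    {n : ℕ} (hn : n ≤ N) : |Polynomial.aeval x (Polynomial.hermite n)| ≤ (2 * r) ^ n := by
  induction n using Nat.twoStepInduction with
  | zero => simp
  | one => simp; linarith
  | more n ih1 ih2 =>
    have h1 := ih1 (by omega)
    have h2 := ih2 (by omega)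
    have h3 : (n + 1 : ℝ) ≤ r ^ 2 := le_trans (by exact_mod_cast (by omega : n + 1 ≤ N)) hN
    rw [aeval_hermite_succ_succ]
    refine (abs_sub _ _).trans ?_
    rw [abs_mul, abs_mul, abs_of_nonneg (by positivity : (0 : ℝ) ≤ n + 1)]
    have h4 := mul_le_mul hx h2 (abs_nonneg _) hr.le
    have h5 := mul_le_mul h3 h1 (abs_nonneg _) (by positivity)
    have h6 : 0 ≤ r ^ 2 * (2 * r) ^ n := by positivity
    calc _ ≤ r * (2 * r) ^ (n + 1) + r ^ 2 * (2 * r) ^ n := add_le_add h4 h5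
      _ ≤ (2 * r) ^ (n + 2) := by rw [pow_succ, pow_add]; nlinarith

/-- `f` is a polynomial function of degree less than `k` whose coefficients have absolute sum at
most `B`. -/
def IsPolyBounded (k : ℕ) (B : ℝ) (f : ℝ → ℝ) : Prop :=
  ∃ c : ℕ → ℝ, (∀ t, f t = ∑ i ∈ Finset.range k, c i * t ^ i) ∧ ∑ i ∈ Finset.range k, |c i| ≤ B

namespace IsPolyBounded

variable {k : ℕ} {B B' : ℝ} {f g : ℝ → ℝ}

theorem mono (hf : IsPolyBounded k B f) (h : B ≤ B') : IsPolyBounded k B' f := by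
  obtain ⟨c, h1, h2⟩ := hf
  exact ⟨c, h1, h2.trans h⟩

theorem add (hf : IsPolyBounded k B f) (hg : IsPolyBounded k B' g) :
    IsPolyBounded k (B + B') (fun t => f t + g t) := by
  obtain ⟨c, h1, h2⟩ := hf
  obtain ⟨c', h1', h2'⟩ := hg
  refine ⟨fun i => c i + c' i, fun t => ?_, ?_⟩
  · simp only [h1, h1', add_mul, Finset.sum_add_distrib]
  · refine le_trans ?_ (add_le_add h2 h2')
    rw [← Finset.sum_add_distrib]
    exact Finset.sum_le_sum fun i _ => abs_add_le _ _

theorem const_mul (hf : IsPolyBounded k B f) (a : ℝ) :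
    IsPolyBounded k (|a| * B) (fun t => a * f t) := by
  obtain ⟨c, h1, h2⟩ := hf
  refine ⟨fun i => a * c i, fun t => ?_, ?_⟩
  · simp only [h1, Finset.mul_sum, mul_assoc]
  · simp only [abs_mul, ← Finset.mul_sum]
    exact mul_le_mul_of_nonneg_left h2 (abs_nonneg _)

theorem id_mul (hf : IsPolyBounded k B f) : IsPolyBounded (k + 1) B (fun t => t * f t) := by
  obtain ⟨c, h1, h2⟩ := hf
  refine ⟨fun i => if i = 0 then 0 else c (i - 1), fun t => ?_, ?_⟩
  · beta_reduce
    rw [Finset.sum_range_succ', h1, Finset.mul_sum]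
    simp [pow_succ, mul_comm, mul_left_comm]
  · rw [Finset.sum_range_succ']
    simpa using h2

theorem succ (hf : IsPolyBounded k B f) : IsPolyBounded (k + 1) B f := by
  obtain ⟨c, h1, h2⟩ := hf
  refine ⟨fun i => if i = k then 0 else c i, fun t => ?_, ?_⟩
  · rw [h1, Finset.sum_range_succ]
    beta_reduce
    rw [if_pos rfl, zero_mul, add_zero]
    exact Finset.sum_congr rfl fun i hi => by rw [if_neg (Finset.mem_range.1 hi).ne]
  · rw [Finset.sum_range_succ]
    beta_reduce
    rw [if_pos rfl, abs_zero, add_zero]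
    refine le_trans (le_of_eq ?_) h2
    exact Finset.sum_congr rfl fun i hi => by rw [if_neg (Finset.mem_range.1 hi).ne]

/-- The factor `2M t - M` has coefficients of absolute sum `3M`. -/
theorem affine_mul (hf : IsPolyBounded k B f) {M : ℝ} (hM : 0 ≤ M) :
    IsPolyBounded (k + 1) (3 * M * B) (fun t => M * (2 * t - 1) * f t) := by
  have h := (hf.id_mul.const_mul (2 * M)).add (hf.const_mul (-M)).succ
  rw [abs_neg, abs_of_nonneg hM, abs_of_nonneg (by positivity)] at h
  convert h using 1
  · ring
  · funext t; ring

end IsPolyBounded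

/-- Same induction as for the values, now with `12 M² + M² ≤ (4M)²`. -/
theorem isPolyBounded_hermite {N : ℕ} {M : ℝ} (hM : 1 ≤ M) (hN : N ≤ M ^ 2) {n : ℕ} (hn : n ≤ N) :
    IsPolyBounded (n + 1) ((4 * M) ^ n)
      (fun t => Polynomial.aeval (M * (2 * t - 1)) (Polynomial.hermite n)) := by
  have h0 : IsPolyBounded 1 1 (fun _ => 1) := ⟨fun _ => 1, by simp, by simp⟩
  induction n using Nat.twoStepInduction with
  | zero => simpa using h0
  | one =>
    have h := (h0.affine_mul (zero_le_one.trans hM)).mono (B' := 4 * M) (by linarith)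
    simpa using h
  | more n ih1 ih2 =>
    have h1 := ih1 (by omega)
    have h2 := ih2 (by omega)
    have h3 : (n + 1 : ℝ) ≤ M ^ 2 := le_trans (by exact_mod_cast (by omega : n + 1 ≤ N)) hN
    have h := (h2.affine_mul (zero_le_one.trans hM)).add (h1.const_mul (-(n + 1))).succ.succ
    simp only [aeval_hermite_succ_succ]
    simp only [neg_mul, ← sub_eq_add_neg] at h
    refine h.mono ?_
    rw [abs_neg, abs_of_nonneg (by positivity)]
    have h4 : (n + 1) * (4 * M) ^ n ≤ M ^ 2 * (4 * M) ^ n := by gcongr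
    have h5 : 0 ≤ M ^ 2 * (4 * M) ^ n := by positivity
    calc _ ≤ 3 * M * (4 * M) ^ (n + 1) + M ^ 2 * (4 * M) ^ n := by gcongr
      _ ≤ (4 * M) ^ (n + 2) := by rw [pow_succ, pow_add]; nlinarith

theorem one_le_sqrt_factorial (n : ℕ) : 1 ≤ √(n.factorial : ℝ) :=
  Real.one_le_sqrt.2 (by exact_mod_cast n.factorial_pos)

theorem isPolyBounded_hermiteH {n : ℕ} {M : ℝ} (hM : 1 ≤ M) (hn : n ≤ M ^ 2) :
    IsPolyBounded (n + 1) ((4 * M) ^ n) (fun t => hermiteH n (M * (2 * t - 1))) := by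
  have h := (isPolyBounded_hermite hM hn le_rfl).const_mul (√(n.factorial : ℝ))⁻¹
  simp only [hermiteH_eq_hermite]
  simp only [div_eq_inv_mul]
  refine h.mono (mul_le_of_le_one_left (by positivity) ?_)
  rw [abs_of_nonneg (by positivity)]
  exact inv_le_one_of_one_le₀ (one_le_sqrt_factorial n)

theorem abs_hermiteH_le {n : ℕ} {x r : ℝ} (hr : 0 < r) (hn : n ≤ r ^ 2) (hx : |x| ≤ r) :
    |hermiteH n x| ≤ (2 * r) ^ n := by
  rw [hermiteH_eq_hermite, abs_div, abs_of_nonneg (Real.sqrt_nonneg _)]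
  exact (div_le_self (abs_nonneg _) (one_le_sqrt_factorial n)).trans
    (abs_aeval_hermite_le hr hn hx le_rfl)

/-- The normalization matters here: `(2|x|) ^ (2n) / n! = 32 ^ n (x²/8) ^ n / n!`, and the last
quotient is a term of the series of `exp(x²/8)`. -/
theorem hermiteH_sq_le {n : ℕ} {x : ℝ} (hx : x ≠ 0) (hn : n ≤ x ^ 2) :
    hermiteH n x ^ 2 ≤ 32 ^ n * Real.exp (x ^ 2 / 8) := by
  have h := abs_aeval_hermite_le (abs_pos.2 hx) (by rwa [sq_abs]) le_rfl le_rfl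
  have h2 := pow_le_pow_left₀ (abs_nonneg _) h 2
  rw [sq_abs] at h2
  have hf : (0 : ℝ) < n.factorial := by exact_mod_cast n.factorial_pos
  rw [hermiteH_eq_hermite, div_pow, Real.sq_sqrt hf.le]
  have h3 := Real.pow_div_factorial_le_exp (x := x ^ 2 / 8) (by positivity) n
  calc _ ≤ ((2 * |x|) ^ n) ^ 2 / n.factorial := by gcongr
    _ = 32 ^ n * ((x ^ 2 / 8) ^ n / n.factorial) := by
      rw [← mul_div_assoc, ← mul_pow, ← pow_mul, mul_comm n 2, pow_mul, mul_pow, sq_abs]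
      congr 2
      ring
    _ ≤ _ := by gcongr

/-! ### Gaussian integrals -/

-- Against the density, `exp(-x²/8)` remains, so the value is `√(8π) / √(2π)`.
open MeasureTheory ProbabilityTheory in
theorem lintegral_exp_gaussianReal :
    ∫⁻ x : ℝ, ENNReal.ofReal (Real.exp (3 / 8 * x ^ 2)) ∂(gaussianReal 0 1) = 2 := by
  rw [gaussianReal_of_var_ne_zero 0 one_ne_zero,
    lintegral_withDensity_eq_lintegral_mul _ (measurable_gaussianPDF 0 1) (by fun_prop)]
  have h : ∀ x : ℝ, (gaussianPDF 0 1 * fun x => ENNReal.ofReal (Real.exp (3 / 8 * x ^ 2))) x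
      = ENNReal.ofReal ((√(2 * Real.pi))⁻¹ * Real.exp (-(1 / 8) * x ^ 2)) := by
    intro x
    rw [Pi.mul_apply, gaussianPDF, gaussianPDFReal, ← ENNReal.ofReal_mul (by positivity), mul_assoc,
      ← Real.exp_add]
    simp
    ring_nf
  simp only [h]
  rw [← ofReal_integral_eq_lintegral_ofReal
    ((integrable_exp_neg_mul_sq (by norm_num)).const_mul _) (ae_of_all _ fun x => by positivity),
    integral_const_mul, integral_gaussian, ← Real.sqrt_inv, ← Real.sqrt_mul (by positivity),
    show (2 * Real.pi)⁻¹ * (Real.pi / (1 / 8)) = 2 ^ 2 by field_simp; norm_num,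
    Real.sqrt_sq (by norm_num)]
  simp

open MeasureTheory ProbabilityTheory in
theorem eLpNorm_two_gaussianReal_le {f : ℝ → ℝ} {a b : ℝ} (ha : 0 ≤ a) (hb : 0 ≤ b)
    (hf : ∀ x, f x ^ 2 ≤ a + b * Real.exp (3 / 8 * x ^ 2)) :
    eLpNorm f 2 (gaussianReal 0 1) ≤ ENNReal.ofReal (√(a + b * 2)) := by
  rw [eLpNorm_eq_lintegral_rpow_enorm_toReal two_ne_zero ENNReal.ofNat_ne_top, Real.sqrt_eq_rpow,
    ← ENNReal.ofReal_rpow_of_nonneg (by positivity) (by norm_num), ENNReal.toReal_ofNat]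
  refine ENNReal.rpow_le_rpow ?_ (by norm_num)
  calc _ ≤ ∫⁻ x, (ENNReal.ofReal a + ENNReal.ofReal b *
        ENNReal.ofReal (Real.exp (3 / 8 * x ^ 2))) ∂(gaussianReal 0 1) := by
        refine lintegral_mono fun x => ?_
        rw [← ENNReal.ofReal_mul hb, ← ENNReal.ofReal_add ha (by positivity), Real.enorm_eq_ofReal_abs,
          ENNReal.ofReal_rpow_of_nonneg (abs_nonneg _) zero_le_two, Real.rpow_two, sq_abs]
        exact ENNReal.ofReal_le_ofReal (hf x)
    _ = _ := by
      rw [lintegral_add_left measurable_const, lintegral_const_mul _ (by fun_prop),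
        lintegral_exp_gaussianReal, ENNReal.ofReal_add ha (by positivity), ENNReal.ofReal_mul hb]
      simp

/-! ### The truncation radius and the number of refinements -/

section TruncationRadius

variable {n : ℕ} {ε : ℝ}

theorem one_lt_neg_log (hε : 0 < ε) (hε' : ε < Real.exp (-1)) : 1 < -Real.log ε := by
  have := (Real.log_lt_iff_lt_exp hε).2 hε'
  linarith

theorem half_le_log_two_mul (hn : 1 ≤ n) : 1 / 2 ≤ Real.log (2 * (n : ℝ)) := by
  have h : Real.log 2 ≤ Real.log (2 * n) := by
    apply Real.log_le_log two_pos
    have : (1 : ℝ) ≤ n := by exact_mod_cast hn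
    linarith
  linarith [Real.log_two_gt_d9]

theorem truncRadius_sq (hn : 1 ≤ n) (hε : 0 < ε) (hε' : ε < Real.exp (-1)) :
    truncRadius n ε ^ 2 = 24 * (n * Real.log (2 * n) - Real.log ε) := by
  have h1 := one_lt_neg_log hε hε'
  have h2 := half_le_log_two_mul hn
  have h3 : 0 ≤ n * Real.log (2 * n) := by positivity
  rw [truncRadius, Real.sq_sqrt (by linarith)]

theorem twelve_mul_le_truncRadius_sq (hn : 1 ≤ n) (hε : 0 < ε) (hε' : ε < Real.exp (-1)) :
    12 * n ≤ truncRadius n ε ^ 2 := by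
  rw [truncRadius_sq hn hε hε']
  have h1 := one_lt_neg_log hε hε'
  have h2 := mul_le_mul_of_nonneg_left (half_le_log_two_mul hn) (Nat.cast_nonneg (α := ℝ) n)
  linarith

theorem one_le_truncRadius (hn : 1 ≤ n) (hε : 0 < ε) (hε' : ε < Real.exp (-1)) :
    1 ≤ truncRadius n ε := by
  have h := twelve_mul_le_truncRadius_sq hn hε hε'
  have h1 : (1 : ℝ) ≤ n := by exact_mod_cast hn
  have h2 : 0 ≤ truncRadius n ε := Real.sqrt_nonneg _
  nlinarith

/-- This is where `24` and `12/13` are used: `(12/13)² · 24 / 4 > 5`, which beats both `32 ^ n =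
exp(5 n log 2)` and `ε²`. -/
theorem exp_neg_truncRadius_le (hn : 1 ≤ n) (hε : 0 < ε) (hε' : ε < Real.exp (-1)) :
    32 ^ n * Real.exp (-(12 / 13 * truncRadius n ε) ^ 2 / 4) ≤ ε ^ 2 := by
  have h1 := one_lt_neg_log hε hε'
  have h2 : (5 : ℝ) * Real.log 2 * n ≤ 5 * (n * Real.log (2 * n)) := by
    have : Real.log 2 ≤ Real.log (2 * n) := by
      apply Real.log_le_log two_pos
      have : (1 : ℝ) ≤ n := by exact_mod_cast hn
      linarith
    nlinarith [Nat.cast_nonneg (α := ℝ) n]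
  have h3 : (0 : ℝ) ≤ 5 * Real.log 2 * n := by positivity
  have h4 : (32 : ℝ) ^ n = Real.exp (5 * Real.log 2 * n) := by
    rw [mul_comm _ (n : ℝ), Real.exp_nat_mul, show (5 : ℝ) = (5 : ℕ) by norm_num, Real.exp_nat_mul,
      Real.exp_log two_pos]
    norm_num
  have h5 : ε ^ 2 = Real.exp (2 * Real.log ε) := by
    rw [show (2 : ℝ) = (2 : ℕ) by norm_num, Real.exp_nat_mul, Real.exp_log hε]
  rw [h4, h5, ← Real.exp_add, Real.exp_le_exp, neg_div, mul_pow, truncRadius_sq hn hε hε']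
  linarith

theorem log_four_mul_truncRadius_le (hn : 1 ≤ n) (hε : 0 < ε) (hε' : ε < Real.exp (-1)) :
    Real.log (4 * truncRadius n ε) ≤ 4 + Real.log n + Real.log (-Real.log ε) := by
  have h1 := one_lt_neg_log hε hε'
  have hn' : (1 : ℝ) ≤ n := by exact_mod_cast hn
  have hM := one_le_truncRadius hn hε hε'
  have h2 : (4 * truncRadius n ε) ^ 2 ≤ Real.exp 8 * n ^ 2 * (-Real.log ε) ^ 2 := by
    have h3 : Real.log (2 * n) ≤ 2 * n := Real.log_le_self (by positivity)
    have h4 : n * Real.log (2 * n) ≤ 2 * (n : ℝ) ^ 2 := by nlinarith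
    have h5 : (1152 : ℝ) ≤ Real.exp 8 := by
      have h6 := pow_le_pow_left₀ (by norm_num) Real.exp_one_gt_d9.le 8
      rw [← Real.exp_nat_mul] at h6
      norm_num at h6
      linarith
    have h6 : (n : ℝ) ^ 2 ≤ n ^ 2 * (-Real.log ε) ^ 2 :=
      le_mul_of_one_le_right (by positivity) (one_le_pow₀ h1.le)
    have h7 : -Real.log ε ≤ n ^ 2 * (-Real.log ε) ^ 2 := by
      have h8 : -Real.log ε ≤ (-Real.log ε) ^ 2 := by nlinarith
      exact h8.trans (le_mul_of_one_le_left (by positivity) (one_le_pow₀ hn'))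
    rw [mul_pow, truncRadius_sq hn hε hε', mul_assoc]
    calc _ ≤ 1152 * ((n : ℝ) ^ 2 * (-Real.log ε) ^ 2) := by linarith
      _ ≤ _ := by gcongr
  have h3 := Real.log_le_log (by positivity) h2
  rw [Real.log_mul (by positivity) (by positivity), Real.log_mul (by positivity) (by positivity),
    Real.log_exp, Real.log_pow, Real.log_pow, Real.log_pow] at h3
  push_cast at h3
  linarith

/-- The number of refinements that makes the approximation of squares accurate enough for the
Hermite polynomial of degree `n` and the accuracy `ε`. -/
noncomputable def numRefinements (n : ℕ) (ε : ℝ) : ℕ :=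
  ⌈Real.log (3 * n) + n * Real.log (4 * truncRadius n ε) - Real.log ε⌉₊

/-- Coefficient sum times error per power; the ceiling is taken of a natural logarithm, and `e ≤ 4`.
-/
theorem error_numRefinements_le (hn : 1 ≤ n) (hε : 0 < ε) (hε' : ε < Real.exp (-1)) :
    (4 * truncRadius n ε) ^ n * (3 * n * (1 / 4 ^ numRefinements n ε)) ≤ ε := by
  have hM := one_le_truncRadius hn hε hε'
  have hn' : (1 : ℝ) ≤ n := by exact_mod_cast hn
  have h1 : 3 * n * (4 * truncRadius n ε) ^ n / ε ≤ 4 ^ numRefinements n ε := by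
    calc _ = Real.exp (Real.log (3 * n) + n * Real.log (4 * truncRadius n ε) - Real.log ε) := by
          rw [Real.exp_sub, Real.exp_add, Real.exp_log (by positivity), Real.exp_log hε,
            Real.exp_nat_mul, Real.exp_log (by positivity)]
      _ ≤ Real.exp (numRefinements n ε) := Real.exp_le_exp.2 (Nat.le_ceil _)
      _ = Real.exp 1 ^ numRefinements n ε := by rw [← Real.exp_nat_mul, mul_one]
      _ ≤ _ := by
        have := Real.exp_one_lt_d9
        gcongr
        linarith
  rw [div_le_iff₀ hε] at h1
  calc _ = 3 * n * (4 * truncRadius n ε) ^ n / 4 ^ numRefinements n ε := by ring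
    _ ≤ ε := by
      rw [div_le_iff₀ (by positivity)]
      linarith

theorem numRefinements_add_five_le (hn : 1 ≤ n) (hε : 0 < ε) (hε' : ε < Real.exp (-1)) :
    (numRefinements n ε : ℝ) + 5 ≤
      16 * (n * (Real.log n + Real.log (-Real.log ε)) - Real.log ε) := by
  have hM := one_le_truncRadius hn hε hε'
  have hn' : (1 : ℝ) ≤ n := by exact_mod_cast hn
  have hL := one_lt_neg_log hε hε'
  have h0 := Real.log_nonneg hn'
  have hLL := Real.log_pos hL
  have h1 : (numRefinements n ε : ℝ) <
      Real.log (3 * n) + n * Real.log (4 * truncRadius n ε) - Real.log ε + 1 := by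
    have ha : 0 ≤ Real.log (3 * n) := Real.log_nonneg (by linarith)
    have hb : 0 ≤ n * Real.log (4 * truncRadius n ε) :=
      mul_nonneg (by positivity) (Real.log_nonneg (by linarith))
    exact Nat.ceil_lt_add_one (by linarith)
  have h2 := mul_le_mul_of_nonneg_left (log_four_mul_truncRadius_le hn hε hε')
    (Nat.cast_nonneg (α := ℝ) n)
  have h3 : Real.log (3 * n) ≤ 2 + Real.log n := by
    rw [Real.log_mul (by norm_num) (by positivity)]
    linarith [Real.log_le_sub_one_of_pos (x := 3) (by norm_num)]
  have h4 : Real.log n ≤ n * Real.log n := le_mul_of_one_le_left h0 hn'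
  -- A bare multiple of `n` is absorbed by `n log n`, except for `n = 1`, where `-log ε > 1` takes
  -- over.
  have h5 : (n : ℝ) ≤ 2 * (n * Real.log n) - Real.log ε := by
    rcases hn.eq_or_lt with rfl | hn2
    · simp; linarith
    · have : Real.log 2 ≤ Real.log n := Real.log_le_log two_pos (by exact_mod_cast hn2)
      have := Real.log_two_gt_d9
      nlinarith
  have h6 : 0 ≤ n * Real.log (-Real.log ε) := by positivity
  linarith

end TruncationRadius

/-! ### Complexity and error of the final network -/

/-- No additive constant is allowed: this factor multiplies `K + 5`, and the depth bound stays
bounded in `ε` when `n = 1`. -/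
theorem clog_two_le (n : ℕ) : (Nat.clog 2 n : ℝ) ≤ 4 * Real.log n := by
  rcases Nat.lt_or_ge 1 n with hn | hn
  · have h1 := Nat.pow_pred_clog_lt_self one_lt_two hn
    have h2 := Real.log_le_log (by positivity) (Nat.cast_le (α := ℝ).2 h1.le)
    rw [Nat.cast_pow, Real.log_pow, Nat.cast_ofNat, Nat.pred_eq_sub_one,
      Nat.cast_pred (Nat.clog_pos one_lt_two hn)] at h2
    have h3 : Real.log 2 ≤ Real.log n := Real.log_le_log two_pos (by exact_mod_cast hn)
    have h4 := Real.log_two_gt_d9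
    have h5 : (1 : ℝ) ≤ Nat.clog 2 n := by exact_mod_cast Nat.clog_pos one_lt_two hn
    nlinarith
  · rw [Nat.clog_of_right_le_one hn, Nat.cast_zero]
    exact mul_nonneg zero_le_four (Real.log_natCast_nonneg n)

theorem two_pow_clog_two_le {n : ℕ} (hn : 1 ≤ n) : 2 ^ Nat.clog 2 n ≤ 2 * n := by
  rcases hn.eq_or_lt with rfl | hn
  · simp
  · have h1 := Nat.pow_pred_clog_lt_self one_lt_two hn
    have h2 := Nat.clog_pos one_lt_two hn
    obtain ⟨k, hk⟩ := Nat.exists_eq_succ_of_ne_zero h2.ne'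
    rw [hk] at h1 ⊢
    rw [pow_succ]
    simp at h1
    omega

/-- For `|x| ≤ R`, `|P| ≤ (2M) ^ n + ε ≤ B` and the truncation does nothing. For `R < |x| ≤ M` the
error is at most `max |H_n| ε`, and beyond `M` it is `|H_n|`. -/
theorem sq_hermiteH_sub_truncation_le {n : ℕ} {ε : ℝ} (hn : 1 ≤ n) (hε : 0 < ε)
    (hε' : ε < Real.exp (-1)) {R M B : ℝ} (hM : M = truncRadius n ε) (hR : R = 12 / 13 * M)
    (hB : B = 1 + (3 * M) ^ n) {P : ℝ → ℝ} (hP : ∀ x, |x| ≤ M → |P x - hermiteH n x| ≤ ε) (x : ℝ) :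
    (hermiteH n x - (relu (P x + B * clip ((M - |x|) / (M - R)))
        - relu (P x - B * clip ((M - |x|) / (M - R))) - B * clip ((M - |x|) / (M - R)))) ^ 2
      ≤ ε ^ 2 + 32 ^ n * Real.exp (-R ^ 2 / 4) * Real.exp (3 / 8 * x ^ 2) := by
  have hM1 : 1 ≤ M := hM ▸ one_le_truncRadius hn hε hε'
  have hM2 : 12 * n ≤ M ^ 2 := hM ▸ twelve_mul_le_truncRadius_sq hn hε hε'
  have hn0 : (0 : ℝ) ≤ n := Nat.cast_nonneg n
  have hR0 : 0 < R := by linarith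
  have hB0 : 0 ≤ B := by rw [hB]; positivity
  have hv : 0 ≤ B * clip ((M - |x|) / (M - R)) := mul_nonneg hB0 (clip_mem _).1
  have htail : 0 ≤ 32 ^ n * Real.exp (-R ^ 2 / 4) * Real.exp (3 / 8 * x ^ 2) := by positivity
  rcases le_or_gt |x| R with hx | hx
  · have hxM : |x| ≤ M := by linarith
    have hχ : clip ((M - |x|) / (M - R)) = 1 :=
      clip_of_one_le ((one_le_div (by linarith)).2 (by linarith))
    have hH := abs_hermiteH_le (n := n) (by linarith) (by nlinarith) hxM
    have hPB : |P x| ≤ B := by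
      have h1 := abs_sub_abs_le_abs_sub (P x) (hermiteH n x)
      have h2 := hP x hxM
      have h3 : Real.exp (-1) ≤ 1 := Real.exp_le_one_iff.2 (by norm_num)
      have h4 : (2 * M) ^ n ≤ (3 * M) ^ n := by gcongr; norm_num
      linarith
    rw [hχ, mul_one, relu_add_sub_relu_sub_of_abs_le hPB, sub_sq_comm, ← sq_abs]
    have := pow_le_pow_left₀ (abs_nonneg _) (hP x hxM) 2
    linarith
  · have hx2 : R ^ 2 ≤ x ^ 2 := by
      rw [← sq_abs x]
      exact pow_le_pow_left₀ hR0.le hx.le 2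
    have hH : hermiteH n x ^ 2 ≤ 32 ^ n * Real.exp (-R ^ 2 / 4) * Real.exp (3 / 8 * x ^ 2) := by
      refine (hermiteH_sq_le (abs_pos.1 (hR0.trans hx)) (by rw [hR] at hx2; nlinarith)).trans ?_
      rw [mul_assoc, ← Real.exp_add]
      gcongr
      linarith
    rcases le_or_gt |x| M with hxM | hxM
    · rw [relu_add_sub_relu_sub_eq hv, sub_sq_comm, ← sq_abs]
      have h1 := pow_le_pow_left₀ (abs_nonneg _)
        (abs_max_neg_min_sub_le (p := P x) hv (hermiteH n x)) 2
      rcases le_total |hermiteH n x| |P x - hermiteH n x| with h | h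
      · rw [max_eq_right h] at h1
        have := pow_le_pow_left₀ (abs_nonneg _) (hP x hxM) 2
        linarith
      · rw [max_eq_left h, sq_abs (hermiteH n x)] at h1
        nlinarith
    · have hχ : clip ((M - |x|) / (M - R)) = 0 :=
        clip_of_nonpos (div_nonpos_of_nonpos_of_nonneg (by linarith) (by linarith))
      rw [hχ, mul_zero, add_zero, sub_zero, sub_zero, sub_self, sub_zero]
      nlinarith

theorem corollary3p4 :
    ∃ C : ℝ, 0 < C ∧
      ∀ n : ℕ, 1 ≤ n → ∀ ε : ℝ, 0 < ε → ε < Real.exp (-1) →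
        ∃ Φ : NeuralNetwork 1 1,
          MeasureTheory.eLpNorm (fun x : ℝ => hermiteH n x - Φ.reluFun x) 2
              (ProbabilityTheory.gaussianReal 0 1) ≤ ENNReal.ofReal (2 * ε) ∧
          (∀ x : ℝ, truncRadius n ε < |x| → Φ.reluFun x = 0) ∧
          (∀ x : ℝ, |Φ.reluFun x| ≤ 1 + (3 * truncRadius n ε) ^ n) ∧
          (Φ.size : ℝ) ≤
            C * (1 + (n : ℝ) ^ 2 * (Real.log n + Real.log (-Real.log ε)) +
              (n : ℝ) * Real.log ((n : ℝ) / ε)) ∧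
          (Φ.depth : ℝ) ≤
            C * (1 + (n : ℝ) * Real.log n ^ 2 +
              (n : ℝ) * Real.log n * Real.log (-Real.log ε) -
              Real.log n * Real.log ε) := by
  -- The size dictates `C`: its main term has the factor `72 · 2 · 16 = 2304`, and the rest covers
  -- `26 + 3n`.
  refine ⟨2400, by norm_num, fun n hn ε hε hε' => ?_⟩
  have hM1 := one_le_truncRadius hn hε hε'
  have hM2 := twelve_mul_le_truncRadius_sq hn hε hε'
  have htail := exp_neg_truncRadius_le hn hε hε'
  have herr := error_numRefinements_le hn hε hε'
  have hK := numRefinements_add_five_le hn hε hε'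
  set M := truncRadius n ε with hM
  set K := numRefinements n ε
  set R := 12 / 13 * M with hR
  set B := 1 + (3 * M) ^ n with hB
  have hn0 : (0 : ℝ) ≤ n := Nat.cast_nonneg n
  have hn1 : (1 : ℝ) ≤ n := by exact_mod_cast hn
  have hB0 : 0 ≤ B := by positivity
  obtain ⟨c, hc, hcB⟩ := isPolyBounded_hermiteH hM1 (show (n : ℝ) ≤ M ^ 2 by linarith)
  obtain ⟨Φ, P, hdepth, hsize, hP, hΦ⟩ := exists_network_truncated_polynomial n K R M B c
  have hP' : ∀ x, |x| ≤ M → |P x - hermiteH n x| ≤ ε := by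
    intro x hx
    obtain ⟨hx1, hx2⟩ := abs_le.1 hx
    have ht : clip ((x + M) / (2 * M)) = (x + M) / (2 * M) :=
      clip_of_mem ⟨div_nonneg (by linarith) (by linarith), (div_le_one (by linarith)).2 (by linarith)⟩
    have h := hP x
    rw [ht, ← hc] at h
    beta_reduce at h
    have e : M * (2 * ((x + M) / (2 * M)) - 1) = x := by
      have : M ≠ 0 := by positivity
      field_simp
      ring
    rw [e] at h
    exact h.trans ((mul_le_mul_of_nonneg_right hcB (by positivity)).trans herr)
  have hL := one_lt_neg_log hε hε'
  have hℓ := Real.log_nonneg hn1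
  have hLL := (Real.log_pos hL).le
  have hJ := clog_two_le n
  refine ⟨Φ, ?_, fun x hx => ?_, fun x => ?_, ?_, ?_⟩
  · refine (eLpNorm_two_gaussianReal_le (sq_nonneg ε)
      (b := 32 ^ n * Real.exp (-R ^ 2 / 4)) (by positivity) fun x => ?_).trans
      (ENNReal.ofReal_le_ofReal ?_)
    · rw [hΦ]
      exact sq_hermiteH_sub_truncation_le hn hε hε' hM hR hB hP' x
    · rw [Real.sqrt_le_left (by positivity)]
      nlinarith
  · have hχ : clip ((M - |x|) / (M - R)) = 0 :=
      clip_of_nonpos (div_nonpos_of_nonpos_of_nonneg (by linarith) (by linarith))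
    rw [hΦ, hχ]
    simp
  · have hv : 0 ≤ B * clip ((M - |x|) / (M - R)) := mul_nonneg hB0 (clip_mem _).1
    rw [hΦ, relu_add_sub_relu_sub_eq hv]
    exact (abs_max_neg_min_le hv).trans (mul_le_of_le_one_right hB0 (clip_mem _).2)
  · have h1 : (Φ.size : ℝ) ≤ 26 + 72 * 2 ^ Nat.clog 2 n * (K + 5) + 3 * n := by
      exact_mod_cast hsize
    have h2 : (2 : ℝ) ^ Nat.clog 2 n ≤ 2 * n := by exact_mod_cast two_pow_clog_two_le hn
    have h3 := mul_le_mul h2 hK (by positivity) (by positivity)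
    rw [Real.log_div (by positivity) hε.ne']
    have h4 := mul_le_mul_of_nonneg_left hL.le hn0
    have h5 : 0 ≤ (n : ℝ) ^ 2 * (Real.log n + Real.log (-Real.log ε)) := by positivity
    have h6 : 0 ≤ n * Real.log n := by positivity
    linarith
  · have h3 := mul_le_mul hJ hK (by positivity) (by positivity)
    have h4 : (Φ.depth : ℝ) = 4 + Nat.clog 2 n * (K + 5) := by rw [hdepth]; push_cast; ring
    have h5 : 0 ≤ n * Real.log n ^ 2 := by positivity
    have h6 : 0 ≤ n * Real.log n * Real.log (-Real.log ε) := by positivity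
    have h7 := mul_nonneg hℓ (zero_le_one.trans hL.le)
    linarith
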